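/- Let $n$ parties have Hilbert spaces $\mathbb{C}^{d_1},\dots,\mathbb{C}^{d_n}$ with $d_i\ge 1$, and let party $i$ have the Hamiltonian $H_i=\sum_{j=0}^{d_i-1}e^i_j|\epsilon^i_j\rangle\langle\epsilon^i_j|$, where $(\epsilon^i_j)_j$ is an orthonormal basis and $0=e^i_0\le e^i_1\le\dots\le e^i_{d_i-1}$. The total Hamiltonian is interaction-free, $H=\sum_{i=1}^n \mathbb{I}\otimes\cdots\otimes H_i\otimes\cdots\otimes\mathbb{I}$. For a unit vector $|\psi\rangle\in\bigotimes_{i=1}^n\mathbb{C}^{d_i}$ and $\rho=|\psi\rangle\langle\psi|$, define the global and the fully local ergotropy $$W^g_e(\psi)=\operatorname{Tr}(\rho H)-\min_{U}\operatorname{Tr}(U\rho U^\dagger H),\qquad W^{A_1|\cdots|A_n}_e(\psi)=\operatorname{Tr}(\rho H)-\min_{U_1,\dots,U_n}\operatorname{Tr}\big((U_1\otimes\cdots\otimes U_n)\rho (U_1\otimes\cdots\otimes U_n)^\dagger H\big),$$ where $U$ ranges over all unitaries on $\bigotimes_i\mathbb{C}^{d_i}$ and $U_i$ over all unitaries on $\mathbb{C}^{d_i}$,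 and the fully separable ergotropic gap $\Delta^{(n)}_{A_1|\cdots|A_n}(\psi)=W^g_e(\psi)-W^{A_1|\cdots|A_n}_e(\psi)$. (a) For every unit vector $|\psi\rangle$, $\Delta^{(n)}_{A_1|\cdots|A_n}(\psi)=\sum_{i=1}^n\operatorname{Tr}(\rho^p_{A_i}H_i)$, where $\rho^p_{A_i}=\sum_j\lambda^i_j|\epsilon^i_j\rangle\langle\epsilon^i_j|$ is the passive state of the marginal $\rho_{A_i}$ of $|\psi\rangle\langle\psi|$ on party $i$, with $\lambda^i_0\ge\lambda^i_1\ge\cdots$ the eigenvalues of $\rho_{A_i}$ counted with multiplicity. (b) For all unit vectors $|\psi\rangle,|\phi\rangle\in\bigotimes_{i=1}^n\mathbb{C}^{d_i}$: if some LOCC protocol transforms $|\psi\rangle$ into $|\phi\rangle$ deterministically, that is, its channel $\Lambda$ satisfies $\Lambda(|\psi\rangle\langle\psi|)=|\phi\rangle\langle\phi|$, then $\Delta^{(n)}_{A_1|\cdots|A_n}(\phi)\le\Delta^{(n)}_{A_1|\cdots|A_n}(\psi)$. Here an LOCC protocol consists of finitely many rounds; in each round every party performs a local measurement given by finitely many Kraus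 operators (possibly trivial, possibly changing the local finite dimension), and all outcomes are announced to all parties, who may choose their later operations accordingly. -/

import Mathlib

open scoped Matrix

namespace ErgotropicGap

noncomputable section

/-- Labels of the product basis of `ℂ^{d 0} ⊗ ⋯ ⊗ ℂ^{d (n-1)}`. -/
abbrev Idx {n : ℕ} (d : Fin n → ℕ) : Type := ∀ i, Fin (d i)

/-- The space `⨂ᵢ ℂ^{dᵢ}`, in coordinates with respect to the product basis. Pure states are its
unit vectors. -/
abbrev Space {n : ℕ} (d : Fin n → ℕ) : Type := EuclideanSpace ℂ (Idx d)

/-- The rank-one operator `|v⟩⟨v|`. -/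
def ketBra {I : Type*} (v : EuclideanSpace ℂ I) : Matrix I I ℂ :=
  Matrix.of fun x y => v x * star (v y)

/-- The product operator `A₀ ⊗ ⋯ ⊗ A₍ₙ₋₁₎`, whose factors may change the local dimensions. -/
def productOp {n : ℕ} {d d' : Fin n → ℕ} (A : ∀ i, Matrix (Fin (d' i)) (Fin (d i)) ℂ) :
    Matrix (Idx d') (Idx d) ℂ :=
  Matrix.of fun x y => ∏ i, A i (x i) (y i)

/-- `𝟙 ⊗ ⋯ ⊗ A ⊗ ⋯ ⊗ 𝟙`, with `A` acting on party `k`. -/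
def extendOp {n : ℕ} {d : Fin n → ℕ} (k : Fin n) (A : Matrix (Fin (d k)) (Fin (d k)) ℂ) :
    Matrix (Idx d) (Idx d) ℂ :=
  productOp (Function.update (fun i => (1 : Matrix (Fin (d i)) (Fin (d i)) ℂ)) k A)

/-- The marginal of party `k`: the partial trace over all the other parties. -/
def reducedState {n : ℕ} {d : Fin n → ℕ} (k : Fin n) (ρ : Matrix (Idx d) (Idx d) ℂ) :
    Matrix (Fin (d k)) (Fin (d k)) ℂ :=
  Matrix.of fun a b => ∑ x : Idx d, if x k = a then ρ x (Function.update x k b) else 0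

/-- The energy `Tr (ρ H)`. -/
def energy {I : Type*} [Fintype I] (ρ H : Matrix I I ℂ) : ℝ := (ρ * H).trace.re

/-- The Hamiltonian `∑ⱼ eⱼ |εⱼ⟩⟨εⱼ|` with energy levels `e` and energy eigenbasis `ε`. -/
def hamiltonian {m : ℕ} (e : Fin m → ℝ)
    (ε : OrthonormalBasis (Fin m) ℂ (EuclideanSpace ℂ (Fin m))) : Matrix (Fin m) (Fin m) ℂ :=
  ∑ j, (e j : ℂ) • ketBra (ε j)

/-- The interaction-free Hamiltonian `∑ᵢ 𝟙 ⊗ ⋯ ⊗ Hᵢ ⊗ ⋯ ⊗ 𝟙`. -/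
def totalHamiltonian {n : ℕ} {d : Fin n → ℕ} (H : ∀ i, Matrix (Fin (d i)) (Fin (d i)) ℂ) :
    Matrix (Idx d) (Idx d) ℂ :=
  ∑ i, extendOp i (H i)

/-- Ergotropy under joint unitaries: `Tr (ρ H) - min_U Tr (U ρ U† H)`. -/
def globalErgotropy {n : ℕ} {d : Fin n → ℕ} (H ρ : Matrix (Idx d) (Idx d) ℂ) : ℝ :=
  energy ρ H - ⨅ U : Matrix.unitaryGroup (Idx d) ℂ,
    energy ((U : Matrix (Idx d) (Idx d) ℂ) * ρ * (U : Matrix (Idx d) (Idx d) ℂ)ᴴ) H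

/-- Ergotropy under fully local unitaries `U₀ ⊗ ⋯ ⊗ U₍ₙ₋₁₎`. -/
def localErgotropy {n : ℕ} {d : Fin n → ℕ} (H ρ : Matrix (Idx d) (Idx d) ℂ) : ℝ :=
  energy ρ H - ⨅ U : ∀ i, Matrix.unitaryGroup (Fin (d i)) ℂ,
    energy (productOp (fun i => (U i : Matrix (Fin (d i)) (Fin (d i)) ℂ)) * ρ *
      (productOp (fun i => (U i : Matrix (Fin (d i)) (Fin (d i)) ℂ)))ᴴ) H

/-- The fully separable ergotropic gap of the pure state `ψ`, for local Hamiltonians `H`. -/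
def ergotropicGap {n : ℕ} {d : Fin n → ℕ} (H : ∀ i, Matrix (Fin (d i)) (Fin (d i)) ℂ)
    (ψ : Space d) : ℝ :=
  globalErgotropy (totalHamiltonian H) (ketBra ψ) - localErgotropy (totalHamiltonian H) (ketBra ψ)

/-- The passive state `∑ⱼ λⱼ |εⱼ⟩⟨εⱼ|` of `ρ`, where `λ₀ ≥ λ₁ ≥ ⋯` are the eigenvalues of `ρ` with
multiplicity and `ε` is an energy eigenbasis listed in the order of increasing energy. -/
def passiveState {m : ℕ} (ε : OrthonormalBasis (Fin m) ℂ (EuclideanSpace ℂ (Fin m)))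
    {ρ : Matrix (Fin m) (Fin m) ℂ} (hρ : ρ.IsHermitian) : Matrix (Fin m) (Fin m) ℂ :=
  ∑ j, (hρ.eigenvalues₀ (Fin.cast (Fintype.card_fin m).symm j) : ℂ) • ketBra (ε j)

theorem reducedState_ketBra_isHermitian {n : ℕ} {d : Fin n → ℕ} (k : Fin n) (ψ : Space d) :
    (reducedState k (ketBra ψ)).IsHermitian := by
  ext a b
  simp only [reducedState, ketBra, Matrix.conjTranspose_apply, Matrix.of_apply, star_sum,
    apply_ite star, star_mul', star_star, star_zero]
  rw [← Finset.sum_filter, ← Finset.sum_filter]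
  refine Finset.sum_bij' (fun x _ => Function.update x k a) (fun x _ => Function.update x k b)
    ?_ ?_ ?_ ?_ ?_
  · simp
  · simp
  · intro x hx
    simp only [Finset.mem_filter, Finset.mem_univ, true_and] at hx
    simp [← hx]
  · intro x hx
    simp only [Finset.mem_filter, Finset.mem_univ, true_and] at hx
    simp [← hx]
  · intro x hx
    simp only [Finset.mem_filter, Finset.mem_univ, true_and] at hx
    simp [← hx, mul_comm]

/-- A finite-round LOCC protocol, with final local dimensions `e` and current local dimensions `d`.
In a round every party `i` performs a local measurement with finitely many Kraus operators
`A i o : ℂ^{d i} → ℂ^{d' i}` (a party that does nothing uses the single operator `1`; local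
ancillas, local discarding and local randomness are covered, as `d'` is arbitrary). The outcomes are
announced to all parties, and the rest of the protocol may depend on them. -/
inductive LOCCProtocol {n : ℕ} (e : Fin n → ℕ) : (Fin n → ℕ) → Type
  | halt : LOCCProtocol e e
  | round {d : Fin n → ℕ} (d' m : Fin n → ℕ)
      (A : ∀ i, Fin (m i) → Matrix (Fin (d' i)) (Fin (d i)) ℂ)
      (hA : ∀ i, ∑ o, (A i o)ᴴ * A i o = 1)
      (next : (∀ i, Fin (m i)) → LOCCProtocol e d') : LOCCProtocol e d

/-- The quantum channel that a protocol implements: the sum over all the outcomes. -/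
def LOCCProtocol.channel {n : ℕ} {e : Fin n → ℕ} : {d : Fin n → ℕ} → LOCCProtocol e d →
    Matrix (Idx d) (Idx d) ℂ → Matrix (Idx e) (Idx e) ℂ
  | _, .halt, ρ => ρ
  | _, .round _ _ A _ next, ρ =>
      ∑ o, (next o).channel
        (productOp (fun i => A i (o i)) * ρ * (productOp (fun i => A i (o i)))ᴴ)

/-- `ψ` can be transformed into `φ` deterministically (with certainty) by LOCC. -/
def LOCCTransforms {n : ℕ} {d : Fin n → ℕ} (ψ φ : Space d) : Prop :=
  ∃ P : LOCCProtocol d d, P.channel (ketBra ψ) = ketBra φ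

end

end ErgotropicGap

/-!
For a single system in the state `ρ` with decreasing eigenvalues `l` and increasing energies `e`, the
least energy that unitaries can reach is `∑ j, l j * e j`, the energy of the passive state: the
squared moduli of the entries of a unitary form a doubly stochastic matrix, so by Birkhoff's theorem
it is enough to compare permutations, which is the rearrangement inequality
(`sum_mul_le_of_mem_doublyStochastic`, `passiveEnergy_le_energy_conj`).

The total Hamiltonian is a sum of local terms, so under local unitaries the energy is the sum of the
energies of the marginals, and each marginal can be made passive independently. A joint unitary can
rotate a pure state to the product of the ground states, whose energy is zero. The difference of the
two ergotropies is therefore the sum of the passive energies of the marginals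
(`ergotropicGap_eq_sum_passiveEnergy`).

For the monotonicity, write the energy levels as a nonnegative combination of the thresholds
`fun j => if k ≤ j then 1 else 0`; it remains to see that the sum of all but the `k` largest
eigenvalues of the marginal of a party does not increase (`passiveEnergy_tail_le`). This sum is
`‖P ψ‖²`, where the projection `P` removes the `k` leading eigenvectors of the marginal. An LOCC
channel has product Kraus operators `K b`. The local factor of `K b` maps the range of `1 - P` into
a space of dimension at most `k`; let `Q b` be a projection, of corank at most `k`, that kills it. Then
`Q b * K b = Q b * K b * P`, so `∑ b, ‖Q b (K b ψ)‖² ≤ ∑ b, ‖K b (P ψ)‖² = ‖P ψ‖²`. Since the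
output is pure, every `K b ψ` is a multiple of `φ`, so that the left-hand side is an average of
energies of `φ`, each of them at least the tail of the spectrum of the marginal of `φ`.
-/

namespace ErgotropicGap

open scoped ComplexOrder

/-! ### Doubly stochastic matrices and passive states -/

/-- The rearrangement inequality for doubly stochastic matrices. The right-hand side is linear in `D`,
so that Birkhoff's theorem reduces it to permutation matrices. -/
theorem sum_mul_le_of_mem_doublyStochastic {m : ℕ} {D : Matrix (Fin m) (Fin m) ℝ}
    (hD : D ∈ doublyStochastic ℝ (Fin m)) {l e : Fin m → ℝ} (hl : Antitone l) (he : Monotone e) :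
    ∑ j, l j * e j ≤ ∑ j, ∑ k, e j * D j k * l k := by
  have hD' : D ∈ convexHull ℝ {x : Matrix (Fin m) (Fin m) ℝ |
      ∃ σ : Equiv.Perm (Fin m), σ.permMatrix ℝ = x} := by
    rw [← doublyStochastic_eq_convexHull_permMatrix]
    exact hD
  have hlin : IsLinearMap ℝ
      (fun D : Matrix (Fin m) (Fin m) ℝ => ∑ j, ∑ k, e j * D j k * l k) := by
    constructor
    · intro x y
      simp [← Finset.sum_add_distrib, mul_add, add_mul]
    · intro c x
      simp only [Matrix.smul_apply, smul_eq_mul, Finset.mul_sum]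
      exact Finset.sum_congr rfl fun j _ => Finset.sum_congr rfl fun k _ => by ring
  refine convexHull_min ?_ (convex_halfSpace_ge hlin (∑ j, l j * e j)) hD'
  rintro _ ⟨σ, rfl⟩
  have hvary : Antivary e l := he.antivary hl
  have h := hvary.sum_mul_le_sum_mul_comp_perm (σ := σ)
  simp only [Set.mem_ofPred_eq, Equiv.Perm.permMatrix, PEquiv.toMatrix_apply,
    Equiv.toPEquiv_apply, Option.mem_some_iff]
  simpa [mul_comm] using h

theorem trace_conj_diagonal_mul_diagonal {I : Type*} [Fintype I] [DecidableEq I]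
    (W : Matrix I I ℂ) (l e : I → ℝ) :
    (W * Matrix.diagonal (fun j => (l j : ℂ)) * Wᴴ * Matrix.diagonal (fun j => (e j : ℂ))).trace.re
      = ∑ j, ∑ k, e j * ‖W j k‖ ^ 2 * l k := by
  simp only [Matrix.trace, Matrix.diag_apply, Matrix.mul_diagonal, Complex.re_sum]
  refine Finset.sum_congr rfl fun j _ => ?_
  rw [Matrix.mul_apply, Finset.sum_mul, Complex.re_sum]
  refine Finset.sum_congr rfl fun k _ => ?_
  rw [Matrix.mul_diagonal, Matrix.conjTranspose_apply]
  have : W j k * (l k : ℂ) * star (W j k) * (e j : ℂ)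
      = ((e j * ‖W j k‖ ^ 2 * l k : ℝ) : ℂ) := by
    have h : W j k * star (W j k) = ((‖W j k‖ ^ 2 : ℝ) : ℂ) := by
      simpa using Complex.mul_conj' (W j k)
    push_cast at h ⊢
    rw [← h]
    ring
  rw [this, Complex.ofReal_re]

theorem normSq_mem_doublyStochastic {I : Type*} [Fintype I] [DecidableEq I]
    {W : Matrix I I ℂ} (hW : W ∈ Matrix.unitaryGroup I ℂ) :
    Matrix.of (fun j k => ‖W j k‖ ^ 2) ∈ doublyStochastic ℝ I := by
  have hmul : ∀ z : ℂ, z * star z = ((‖z‖ ^ 2 : ℝ) : ℂ) := fun z => by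
    simpa using Complex.mul_conj' z
  refine mem_doublyStochastic_iff_sum.2 ⟨fun j k => sq_nonneg _, fun j => ?_, fun k => ?_⟩
  · have h := congrFun (congrFun (Matrix.mem_unitaryGroup_iff.1 hW) j) j
    simp only [Matrix.mul_apply, Matrix.star_apply, hmul, Matrix.one_apply_eq] at h
    exact_mod_cast h
  · have h := congrFun (congrFun (Matrix.mem_unitaryGroup_iff'.1 hW) k) k
    simp only [Matrix.mul_apply, Matrix.star_apply, mul_comm (star _), hmul,
      Matrix.one_apply_eq] at h
    exact_mod_cast h

/-- The unitary matrix whose columns are the vectors of an orthonormal basis. -/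
noncomputable def columns {I : Type*} [Fintype I] [DecidableEq I]
    (b : OrthonormalBasis I ℂ (EuclideanSpace ℂ I)) : Matrix I I ℂ :=
  (EuclideanSpace.basisFun I ℂ).toBasis.toMatrix b.toBasis

theorem columns_mem_unitaryGroup {I : Type*} [Fintype I] [DecidableEq I]
    (b : OrthonormalBasis I ℂ (EuclideanSpace ℂ I)) : columns b ∈ Matrix.unitaryGroup I ℂ :=
  (EuclideanSpace.basisFun I ℂ).toMatrix_orthonormalBasis_mem_unitary b

@[simp]
theorem columns_apply {I : Type*} [Fintype I] [DecidableEq I]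
    (b : OrthonormalBasis I ℂ (EuclideanSpace ℂ I)) (x y : I) :
    columns b x y = b y x := rfl

theorem columns_conjTranspose_mul {I : Type*} [Fintype I] [DecidableEq I]
    (b : OrthonormalBasis I ℂ (EuclideanSpace ℂ I)) :
    (columns b)ᴴ * columns b = 1 :=
  Matrix.mem_unitaryGroup_iff'.1 (columns_mem_unitaryGroup b)

theorem columns_mul_conjTranspose {I : Type*} [Fintype I] [DecidableEq I]
    (b : OrthonormalBasis I ℂ (EuclideanSpace ℂ I)) :
    columns b * (columns b)ᴴ = 1 :=
  Matrix.mem_unitaryGroup_iff.1 (columns_mem_unitaryGroup b)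

theorem hamiltonian_eq_conj_diagonal {m : ℕ} (e : Fin m → ℝ)
    (b : OrthonormalBasis (Fin m) ℂ (EuclideanSpace ℂ (Fin m))) :
    hamiltonian e b = columns b * Matrix.diagonal (fun j => (e j : ℂ)) *
      (columns b)ᴴ := by
  ext x y
  simp only [hamiltonian, ketBra, Matrix.sum_apply, Matrix.smul_apply, Matrix.of_apply,
    smul_eq_mul]
  rw [Matrix.mul_apply]
  refine Finset.sum_congr rfl fun j _ => ?_
  rw [Matrix.mul_diagonal, Matrix.conjTranspose_apply, columns_apply, columns_apply]
  ring

theorem conjTranspose_columns_mul_hamiltonian_mul {m : ℕ} (e : Fin m → ℝ)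
    (b : OrthonormalBasis (Fin m) ℂ (EuclideanSpace ℂ (Fin m))) :
    (columns b)ᴴ * hamiltonian e b * columns b =
      Matrix.diagonal (fun j => (e j : ℂ)) := by
  rw [hamiltonian_eq_conj_diagonal, Matrix.mul_assoc, Matrix.mul_assoc, Matrix.mul_assoc,
    columns_conjTranspose_mul, Matrix.mul_one, ← Matrix.mul_assoc, columns_conjTranspose_mul,
    Matrix.one_mul]

theorem hamiltonian_posSemidef {m : ℕ} {e : Fin m → ℝ} (he : ∀ j, 0 ≤ e j)
    (b : OrthonormalBasis (Fin m) ℂ (EuclideanSpace ℂ (Fin m))) :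
    (hamiltonian e b).PosSemidef := by
  rw [hamiltonian_eq_conj_diagonal]
  refine Matrix.PosSemidef.mul_mul_conjTranspose_same ?_ _
  exact Matrix.PosSemidef.diagonal fun j => by simpa using he j

theorem hamiltonian_mul_hamiltonian {m : ℕ} (e f : Fin m → ℝ)
    (b : OrthonormalBasis (Fin m) ℂ (EuclideanSpace ℂ (Fin m))) :
    hamiltonian e b * hamiltonian f b = hamiltonian (fun j => e j * f j) b := by
  have h := columns_conjTranspose_mul b
  simp only [hamiltonian_eq_conj_diagonal]
  generalize columns b = B at h ⊢
  calc _ = B * Matrix.diagonal (fun j => (e j : ℂ)) * (Bᴴ * B) *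
        Matrix.diagonal (fun j => (f j : ℂ)) * Bᴴ := by simp only [Matrix.mul_assoc]
    _ = _ := by
      rw [h, Matrix.mul_one, Matrix.mul_assoc B, Matrix.diagonal_mul_diagonal]
      simp

/-- Conjugating a Hamiltonian by a unitary rotates its eigenbasis. -/
theorem conj_hamiltonian {m : ℕ} (e : Fin m → ℝ) (U : Matrix (Fin m) (Fin m) ℂ)
    (b : OrthonormalBasis (Fin m) ℂ (EuclideanSpace ℂ (Fin m))) :
    Uᴴ * hamiltonian e b * U = (Uᴴ * columns b) * Matrix.diagonal (fun j => (e j : ℂ)) *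
      (Uᴴ * columns b)ᴴ := by
  simp only [hamiltonian_eq_conj_diagonal, Matrix.conjTranspose_mul,
    Matrix.conjTranspose_conjTranspose, Matrix.mul_assoc]

theorem energy_add {I : Type*} [Fintype I] (ρ A B : Matrix I I ℂ) :
    energy ρ (A + B) = energy ρ A + energy ρ B := by
  simp [energy, Matrix.mul_add]

theorem energy_sum {I J : Type*} [Fintype I] (s : Finset J) (ρ : Matrix I I ℂ)
    (A : J → Matrix I I ℂ) : energy ρ (∑ j ∈ s, A j) = ∑ j ∈ s, energy ρ (A j) := by
  simp [energy, Matrix.mul_sum, Matrix.trace_sum]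

theorem energy_conj {I J : Type*} [Fintype I] [Fintype J] (K : Matrix J I ℂ)
    (ρ : Matrix I I ℂ) (M : Matrix J J ℂ) :
    energy (K * ρ * Kᴴ) M = energy ρ (Kᴴ * M * K) := by
  rw [energy, energy, Matrix.mul_assoc, Matrix.mul_assoc, Matrix.trace_mul_comm]
  simp only [Matrix.mul_assoc]

theorem energy_conj_diagonal {I : Type*} [Fintype I] [DecidableEq I]
    (V B : Matrix I I ℂ) (l e : I → ℝ) :
    energy (V * Matrix.diagonal (fun j => (l j : ℂ)) * Vᴴ)
      (B * Matrix.diagonal (fun j => (e j : ℂ)) * Bᴴ) =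
      ∑ j, ∑ k, e j * ‖(Bᴴ * V) j k‖ ^ 2 * l k := by
  rw [← trace_conj_diagonal_mul_diagonal, energy, Matrix.conjTranspose_mul,
    Matrix.conjTranspose_conjTranspose]
  congr 1
  rw [← Matrix.mul_assoc, Matrix.trace_mul_comm]
  simp only [Matrix.mul_assoc]

/-- The eigenvalues of a Hermitian matrix with multiplicity, in decreasing order. -/
noncomputable def spectrumDesc {m : ℕ} {ρ : Matrix (Fin m) (Fin m) ℂ} (hρ : ρ.IsHermitian)
    (j : Fin m) : ℝ :=
  hρ.eigenvalues₀ (Fin.cast (Fintype.card_fin m).symm j)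

theorem spectrumDesc_antitone {m : ℕ} {ρ : Matrix (Fin m) (Fin m) ℂ} (hρ : ρ.IsHermitian) :
    Antitone (spectrumDesc hρ) :=
  fun _ _ h => hρ.eigenvalues₀_antitone h

/-- The spectral theorem with the eigenvalues in decreasing order. The indexing of
`Matrix.IsHermitian.eigenvalues` goes through an unspecified equivalence, which a permutation of the
eigenbasis undoes. -/
theorem exists_eq_hamiltonian_spectrumDesc {m : ℕ} {ρ : Matrix (Fin m) (Fin m) ℂ}
    (hρ : ρ.IsHermitian) : ∃ v : OrthonormalBasis (Fin m) ℂ (EuclideanSpace ℂ (Fin m)),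
      ρ = hamiltonian (spectrumDesc hρ) v := by
  set E : Fin (Fintype.card (Fin m)) ≃ Fin m :=
    Fintype.equivOfCardEq (Fintype.card_fin _) with hE
  set σ : Fin m ≃ Fin m := (finCongr (Fintype.card_fin m).symm).trans E with hσ
  refine ⟨hρ.eigenvectorBasis.reindex σ.symm, ?_⟩
  have h1 : ρ = hamiltonian hρ.eigenvalues hρ.eigenvectorBasis := by
    rw [hamiltonian_eq_conj_diagonal]
    conv_lhs => rw [hρ.spectral_theorem]
    rfl
  conv_lhs => rw [h1]
  rw [hamiltonian, hamiltonian, ← Equiv.sum_comp σ]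
  refine Finset.sum_congr rfl fun j _ => ?_
  have h2 : hρ.eigenvalues (σ j) = spectrumDesc hρ j := by
    simp only [Matrix.IsHermitian.eigenvalues, spectrumDesc, hσ, Equiv.trans_apply]
    rw [← hE, Equiv.symm_apply_apply]
    rfl
  rw [h2]
  simp

/-- The energy of the passive state: the `j`-th largest eigenvalue sits at the `j`-th lowest
level. -/
noncomputable def passiveEnergy {m : ℕ} {ρ : Matrix (Fin m) (Fin m) ℂ} (hρ : ρ.IsHermitian)
    (e : Fin m → ℝ) : ℝ :=
  ∑ j, spectrumDesc hρ j * e j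

theorem energy_hamiltonian_same {m : ℕ} (l e : Fin m → ℝ)
    (b : OrthonormalBasis (Fin m) ℂ (EuclideanSpace ℂ (Fin m))) :
    energy (hamiltonian l b) (hamiltonian e b) = ∑ j, l j * e j := by
  rw [hamiltonian_eq_conj_diagonal, hamiltonian_eq_conj_diagonal, energy_conj_diagonal,
    columns_conjTranspose_mul]
  refine Finset.sum_congr rfl fun j _ => ?_
  rw [Finset.sum_eq_single j]
  · simp [mul_comm]
  · intro k _ hk
    simp [Matrix.one_apply_ne hk.symm]
  · simp

theorem energy_passiveState {m : ℕ} {ρ : Matrix (Fin m) (Fin m) ℂ} (hρ : ρ.IsHermitian)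
    (e : Fin m → ℝ) (ε : OrthonormalBasis (Fin m) ℂ (EuclideanSpace ℂ (Fin m))) :
    energy (passiveState ε hρ) (hamiltonian e ε) = passiveEnergy hρ e :=
  energy_hamiltonian_same (spectrumDesc hρ) e ε

theorem passiveEnergy_le_energy_conj_diagonal {m : ℕ} {ρ : Matrix (Fin m) (Fin m) ℂ}
    (hρ : ρ.IsHermitian) {e : Fin m → ℝ} (he : Monotone e) {B : Matrix (Fin m) (Fin m) ℂ}
    (hB : B ∈ Matrix.unitaryGroup (Fin m) ℂ) :
    passiveEnergy hρ e ≤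
      energy ρ (B * Matrix.diagonal (fun j => (e j : ℂ)) * Bᴴ) := by
  obtain ⟨v, hv⟩ := exists_eq_hamiltonian_spectrumDesc hρ
  conv_rhs => rw [hv]
  rw [hamiltonian_eq_conj_diagonal, energy_conj_diagonal]
  exact sum_mul_le_of_mem_doublyStochastic
    (normSq_mem_doublyStochastic (mul_mem (Unitary.star_mem hB) (columns_mem_unitaryGroup v)))
    (spectrumDesc_antitone hρ) he

theorem passiveEnergy_le_energy_hamiltonian {m : ℕ} {ρ : Matrix (Fin m) (Fin m) ℂ}
    (hρ : ρ.IsHermitian) {e : Fin m → ℝ} (he : Monotone e)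
    (b : OrthonormalBasis (Fin m) ℂ (EuclideanSpace ℂ (Fin m))) :
    passiveEnergy hρ e ≤ energy ρ (hamiltonian e b) := by
  rw [hamiltonian_eq_conj_diagonal]
  exact passiveEnergy_le_energy_conj_diagonal hρ he (columns_mem_unitaryGroup b)

theorem passiveEnergy_le_energy_conj {m : ℕ} {ρ : Matrix (Fin m) (Fin m) ℂ}
    (hρ : ρ.IsHermitian) {e : Fin m → ℝ} (he : Monotone e)
    (ε : OrthonormalBasis (Fin m) ℂ (EuclideanSpace ℂ (Fin m)))
    (U : Matrix.unitaryGroup (Fin m) ℂ) :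
    passiveEnergy hρ e ≤
      energy ρ ((U : Matrix _ _ ℂ)ᴴ * hamiltonian e ε * (U : Matrix _ _ ℂ)) := by
  rw [conj_hamiltonian]
  exact passiveEnergy_le_energy_conj_diagonal hρ he
    (mul_mem (Unitary.star_mem U.2) (columns_mem_unitaryGroup ε))

theorem exists_unitary_energy_eq_passiveEnergy {m : ℕ} {ρ : Matrix (Fin m) (Fin m) ℂ}
    (hρ : ρ.IsHermitian) (e : Fin m → ℝ)
    (ε : OrthonormalBasis (Fin m) ℂ (EuclideanSpace ℂ (Fin m))) :
    ∃ U : Matrix.unitaryGroup (Fin m) ℂ,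
      energy ρ ((U : Matrix _ _ ℂ)ᴴ * hamiltonian e ε * (U : Matrix _ _ ℂ)) =
        passiveEnergy hρ e := by
  obtain ⟨v, hv⟩ := exists_eq_hamiltonian_spectrumDesc hρ
  refine ⟨⟨columns ε * star (columns v), mul_mem (columns_mem_unitaryGroup ε)
    (Unitary.star_mem (columns_mem_unitaryGroup v))⟩, ?_⟩
  have h : (columns ε * star (columns v))ᴴ * columns ε = columns v := by
    simp only [Matrix.star_eq_conjTranspose, Matrix.conjTranspose_mul,
      Matrix.conjTranspose_conjTranspose, Matrix.mul_assoc, columns_conjTranspose_mul,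
      Matrix.mul_one]
  rw [conj_hamiltonian, h, ← hamiltonian_eq_conj_diagonal]
  conv_lhs => rw [hv]
  exact energy_hamiltonian_same _ e v

/-! ### Product operators and marginals -/

theorem productOp_mul {n : ℕ} {d d' d'' : Fin n → ℕ}
    (A : ∀ i, Matrix (Fin (d'' i)) (Fin (d' i)) ℂ) (B : ∀ i, Matrix (Fin (d' i)) (Fin (d i)) ℂ) :
    productOp A * productOp B = productOp fun i => A i * B i := by
  ext x y
  simp only [productOp, Matrix.mul_apply, Matrix.of_apply, Finset.prod_univ_sum,
    Fintype.piFinset_univ, Finset.prod_mul_distrib]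

theorem productOp_conjTranspose {n : ℕ} {d d' : Fin n → ℕ}
    (A : ∀ i, Matrix (Fin (d' i)) (Fin (d i)) ℂ) :
    (productOp A)ᴴ = productOp fun i => (A i)ᴴ := by
  ext x y
  simp [productOp, Matrix.conjTranspose_apply]

theorem productOp_one {n : ℕ} {d : Fin n → ℕ} :
    productOp (fun i => (1 : Matrix (Fin (d i)) (Fin (d i)) ℂ)) = 1 := by
  ext x y
  simp only [productOp, Matrix.of_apply, Matrix.one_apply]
  rw [Fintype.prod_ite_zero]
  simp [funext_iff]

theorem productOp_mem_unitaryGroup {n : ℕ} {d : Fin n → ℕ}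
    {U : ∀ i, Matrix (Fin (d i)) (Fin (d i)) ℂ}
    (hU : ∀ i, U i ∈ Matrix.unitaryGroup (Fin (d i)) ℂ) :
    productOp U ∈ Matrix.unitaryGroup (Idx d) ℂ := by
  rw [Matrix.mem_unitaryGroup_iff, Matrix.star_eq_conjTranspose, productOp_conjTranspose,
    productOp_mul, ← productOp_one]
  congr 1
  funext i
  exact Matrix.mem_unitaryGroup_iff.1 (hU i)

theorem extendOp_mul_productOp {n : ℕ} {d d' : Fin n → ℕ} (k : Fin n)
    (M : Matrix (Fin (d' k)) (Fin (d' k)) ℂ) (A : ∀ i, Matrix (Fin (d' i)) (Fin (d i)) ℂ) :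
    extendOp k M * productOp A = productOp (Function.update A k (M * A k)) := by
  rw [extendOp, productOp_mul]
  congr 1
  funext i
  by_cases h : i = k
  · subst h
    simp
  · simp [h]

theorem productOp_mul_extendOp {n : ℕ} {d d' : Fin n → ℕ} (k : Fin n)
    (M : Matrix (Fin (d k)) (Fin (d k)) ℂ) (A : ∀ i, Matrix (Fin (d' i)) (Fin (d i)) ℂ) :
    productOp A * extendOp k M = productOp (Function.update A k (A k * M)) := by
  rw [extendOp, productOp_mul]
  congr 1
  funext i
  by_cases h : i = k
  · subst h
    simp
  · simp [h]

theorem extendOp_one {n : ℕ} {d : Fin n → ℕ} (k : Fin n) :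
    extendOp k (1 : Matrix (Fin (d k)) (Fin (d k)) ℂ) = 1 := by
  rw [extendOp, Function.update_eq_self, productOp_one]

theorem extendOp_mul {n : ℕ} {d : Fin n → ℕ} (k : Fin n)
    (M N : Matrix (Fin (d k)) (Fin (d k)) ℂ) :
    extendOp k M * extendOp k N = extendOp k (M * N) := by
  conv_lhs => rw [extendOp.eq_1 k N, extendOp_mul_productOp]
  simp [extendOp]

theorem extendOp_conjTranspose {n : ℕ} {d : Fin n → ℕ} (k : Fin n)
    (M : Matrix (Fin (d k)) (Fin (d k)) ℂ) : (extendOp k M)ᴴ = extendOp k Mᴴ := by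
  rw [extendOp, productOp_conjTranspose, extendOp]
  congr 1
  funext i
  by_cases h : i = k
  · subst h
    simp
  · simp [h]

theorem extendOp_apply {n : ℕ} {d : Fin n → ℕ} (k : Fin n)
    (M : Matrix (Fin (d k)) (Fin (d k)) ℂ) (x y : Idx d) :
    extendOp k M x y = if x = Function.update y k (x k) then M (x k) (y k) else 0 := by
  rw [extendOp, productOp, Matrix.of_apply, ← Finset.mul_prod_erase _ _ (Finset.mem_univ k),
    Function.update_self]
  split_ifs with h
  · rw [Finset.prod_eq_one, mul_one]
    intro i hi
    have hik : i ≠ k := Finset.ne_of_mem_erase hi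
    have hx : x i = y i := by
      rw [h]
      simp [hik]
    simp [hik, hx]
  · obtain ⟨i, hi⟩ : ∃ i, x i ≠ Function.update y k (x k) i := by
      by_contra! hne
      exact h (funext hne)
    have hik : i ≠ k := by
      rintro rfl
      simp at hi
    rw [Finset.prod_eq_zero (Finset.mem_erase.2 ⟨hik, Finset.mem_univ i⟩), mul_zero]
    simp only [Function.update_of_ne hik] at hi ⊢
    exact Matrix.one_apply_ne hi

theorem extendOp_sub {n : ℕ} {d : Fin n → ℕ} (k : Fin n)
    (M N : Matrix (Fin (d k)) (Fin (d k)) ℂ) :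
    extendOp k (M - N) = extendOp k M - extendOp k N := by
  ext x y
  simp only [Matrix.sub_apply, extendOp_apply]
  split_ifs <;> simp

theorem productOp_conj_extendOp {n : ℕ} {d : Fin n → ℕ} (k : Fin n)
    (M : Matrix (Fin (d k)) (Fin (d k)) ℂ) {U : ∀ i, Matrix (Fin (d i)) (Fin (d i)) ℂ}
    (hU : ∀ i, U i ∈ Matrix.unitaryGroup (Fin (d i)) ℂ) :
    (productOp U)ᴴ * extendOp k M * productOp U = extendOp k ((U k)ᴴ * M * U k) := by
  rw [Matrix.mul_assoc, extendOp_mul_productOp, productOp_conjTranspose, productOp_mul, extendOp]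
  congr 1
  funext i
  by_cases h : i = k
  · subst h
    simp [Matrix.mul_assoc]
  · simp only [Function.update_of_ne h]
    exact Matrix.mem_unitaryGroup_iff'.1 (hU i)

theorem extendOp_posSemidef {n : ℕ} {d : Fin n → ℕ} (k : Fin n)
    {M : Matrix (Fin (d k)) (Fin (d k)) ℂ} (hM : M.PosSemidef) : (extendOp k M).PosSemidef := by
  obtain ⟨B, rfl⟩ : ∃ B : Matrix (Fin (d k)) (Fin (d k)) ℂ, M = Bᴴ * B := by
    open scoped MatrixOrder in
    exact (CStarAlgebra.nonneg_iff_eq_star_mul_self).1 hM.nonneg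
  rw [← extendOp_mul, ← extendOp_conjTranspose]
  exact Matrix.posSemidef_conjTranspose_mul_self _

/-- The defining property of the marginal: it has the energy of the joint state under every local
Hamiltonian. -/
theorem energy_extendOp {n : ℕ} {d : Fin n → ℕ} (k : Fin n) (ρ : Matrix (Idx d) (Idx d) ℂ)
    (M : Matrix (Fin (d k)) (Fin (d k)) ℂ) :
    energy ρ (extendOp k M) = energy (reducedState k ρ) M := by
  have hl : ∀ x : Idx d, ∑ y, ρ x y * extendOp k M y x =
      ∑ b, ρ x (Function.update x k b) * M b (x k) := by
    intro x
    simp only [extendOp_apply, mul_ite, mul_zero]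
    rw [← Finset.sum_filter]
    symm
    refine Finset.sum_bij' (fun b _ => Function.update x k b) (fun y _ => y k) ?_ ?_ ?_ ?_ ?_
    · simp
    · simp
    · simp
    · intro y hy
      exact ((Finset.mem_filter.1 hy).2).symm
    · simp
  rw [energy, energy]
  congr 1
  simp only [Matrix.trace, Matrix.diag_apply, Matrix.mul_apply, hl, reducedState, Matrix.of_apply,
    Finset.sum_mul, ite_mul, zero_mul]
  conv_rhs => rw [Finset.sum_congr rfl fun a _ => Finset.sum_comm, Finset.sum_comm]
  refine Finset.sum_congr rfl fun x _ => ?_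
  rw [Finset.sum_comm]
  simp

theorem energy_totalHamiltonian {n : ℕ} {d : Fin n → ℕ} (ρ : Matrix (Idx d) (Idx d) ℂ)
    (H : ∀ i, Matrix (Fin (d i)) (Fin (d i)) ℂ) :
    energy ρ (totalHamiltonian H) = ∑ i, energy ρ (extendOp i (H i)) :=
  energy_sum _ _ _

theorem energy_ketBra {I : Type*} [Fintype I] (v : EuclideanSpace ℂ I) (M : Matrix I I ℂ) :
    energy (ketBra v) M = (star v.ofLp ⬝ᵥ M *ᵥ v.ofLp).re := by
  have h : ketBra v = Matrix.vecMulVec v.ofLp (star v.ofLp) := rfl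
  rw [energy, h, Matrix.trace_mul_comm, Matrix.mul_vecMulVec, Matrix.trace_vecMulVec,
    dotProduct_comm]

theorem energy_ketBra_nonneg {I : Type*} [Fintype I] (v : EuclideanSpace ℂ I)
    {M : Matrix I I ℂ} (hM : M.PosSemidef) : 0 ≤ energy (ketBra v) M := by
  rw [energy_ketBra]
  exact hM.re_dotProduct_nonneg _

theorem energy_ketBra_one {I : Type*} [Fintype I] [DecidableEq I] (v : EuclideanSpace ℂ I) :
    energy (ketBra v) 1 = ‖v‖ ^ 2 := by
  rw [energy_ketBra, Matrix.one_mulVec, ← inner_self_eq_norm_sq (𝕜 := ℂ),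
    EuclideanSpace.inner_eq_star_dotProduct, dotProduct_comm]
  rfl

theorem conj_ketBra {I J : Type*} [Fintype I] (K : Matrix J I ℂ) (v : EuclideanSpace ℂ I) :
    K * ketBra v * Kᴴ = ketBra (WithLp.toLp 2 (K *ᵥ v.ofLp)) := by
  have h : ketBra v = Matrix.vecMulVec v.ofLp (star v.ofLp) := rfl
  rw [h, Matrix.mul_vecMulVec, Matrix.vecMulVec_mul, ← Matrix.star_mulVec]
  rfl

/-! ### The gap of a pure state -/

/-- Under local unitaries the energy is the sum of the energies of the marginals, which can be made
passive independently of each other. -/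
theorem localErgotropy_eq {n : ℕ} {d : Fin n → ℕ} {e : ∀ i, Fin (d i) → ℝ}
    (he : ∀ i, Monotone (e i))
    (ε : ∀ i, OrthonormalBasis (Fin (d i)) ℂ (EuclideanSpace ℂ (Fin (d i)))) (ψ : Space d) :
    localErgotropy (totalHamiltonian fun i => hamiltonian (e i) (ε i)) (ketBra ψ) =
      energy (ketBra ψ) (totalHamiltonian fun i => hamiltonian (e i) (ε i)) -
        ∑ i, passiveEnergy (reducedState_ketBra_isHermitian i ψ) (e i) := by
  have hval : ∀ U : ∀ i, Matrix.unitaryGroup (Fin (d i)) ℂ,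
      energy (productOp (fun i => (U i : Matrix (Fin (d i)) (Fin (d i)) ℂ)) * ketBra ψ *
        (productOp (fun i => (U i : Matrix (Fin (d i)) (Fin (d i)) ℂ)))ᴴ)
        (totalHamiltonian fun i => hamiltonian (e i) (ε i)) =
      ∑ i, energy (reducedState i (ketBra ψ)) ((U i : Matrix (Fin (d i)) (Fin (d i)) ℂ)ᴴ *
        hamiltonian (e i) (ε i) * (U i : Matrix (Fin (d i)) (Fin (d i)) ℂ)) := by
    intro U
    rw [energy_totalHamiltonian]
    refine Finset.sum_congr rfl fun i _ => ?_
    rw [energy_conj, productOp_conj_extendOp i _ fun i => (U i).2, energy_extendOp]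
  rw [localErgotropy]
  congr 1
  simp only [hval]
  have hle : ∀ U : ∀ i, Matrix.unitaryGroup (Fin (d i)) ℂ,
      ∑ i, passiveEnergy (reducedState_ketBra_isHermitian i ψ) (e i) ≤
      ∑ i, energy (reducedState i (ketBra ψ)) ((U i : Matrix (Fin (d i)) (Fin (d i)) ℂ)ᴴ *
        hamiltonian (e i) (ε i) * (U i : Matrix (Fin (d i)) (Fin (d i)) ℂ)) := fun U =>
    Finset.sum_le_sum fun i _ => passiveEnergy_le_energy_conj _ (he i) (ε i) (U i)
  choose V hV using fun i => exists_unitary_energy_eq_passiveEnergy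
    (reducedState_ketBra_isHermitian i ψ) (e i) (ε i)
  refine le_antisymm ((ciInf_le ⟨_, Set.forall_mem_range.2 hle⟩ V).trans_eq ?_) (le_ciInf hle)
  exact Finset.sum_congr rfl fun i _ => hV i

theorem exists_orthonormalBasis_apply_eq {I : Type*} [Fintype I] [DecidableEq I] (x : I)
    {ψ : EuclideanSpace ℂ I} (hψ : ‖ψ‖ = 1) :
    ∃ b : OrthonormalBasis I ℂ (EuclideanSpace ℂ I), b x = ψ := by
  have h : Orthonormal ℂ (({x} : Set I).domRestrict fun _ => ψ) := by
    refine ⟨fun _ => hψ, fun i j hij => (hij (Subsingleton.elim i j)).elim⟩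
  obtain ⟨b, hb⟩ := h.exists_orthonormalBasis_extension_of_card_eq (by simp)
  exact ⟨b, hb x rfl⟩

theorem ketBra_orthonormalBasis {I : Type*} [Fintype I] [DecidableEq I]
    (b : OrthonormalBasis I ℂ (EuclideanSpace ℂ I)) (x : I) :
    ketBra (b x) = columns b * Matrix.single x x 1 * (columns b)ᴴ := by
  ext y z
  rw [Matrix.mul_apply, Finset.sum_eq_single x]
  · simp [ketBra]
  · intro w _ hw
    simp [hw]
  · simp

/-- A pure state can be rotated to the product of the ground states, so joint unitaries extract all
of its energy. -/
theorem globalErgotropy_eq {n : ℕ} {d : Fin n → ℕ} [∀ i, NeZero (d i)] {e : ∀ i, Fin (d i) → ℝ}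
    (he : ∀ i, Monotone (e i)) (he0 : ∀ i, e i 0 = 0)
    (ε : ∀ i, OrthonormalBasis (Fin (d i)) ℂ (EuclideanSpace ℂ (Fin (d i)))) {ψ : Space d}
    (hψ : ‖ψ‖ = 1) :
    globalErgotropy (totalHamiltonian fun i => hamiltonian (e i) (ε i)) (ketBra ψ) =
      energy (ketBra ψ) (totalHamiltonian fun i => hamiltonian (e i) (ε i)) := by
  rw [globalErgotropy, sub_eq_self]
  have hle : ∀ U : Matrix.unitaryGroup (Idx d) ℂ,
      0 ≤ energy ((U : Matrix (Idx d) (Idx d) ℂ) * ketBra ψ * (U : Matrix (Idx d) (Idx d) ℂ)ᴴ)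
        (totalHamiltonian fun i => hamiltonian (e i) (ε i)) := by
    intro U
    rw [conj_ketBra, energy_totalHamiltonian]
    refine Finset.sum_nonneg fun i _ => energy_ketBra_nonneg _ (extendOp_posSemidef i ?_)
    exact hamiltonian_posSemidef (fun j => (he0 i).symm.trans_le (he i (Fin.zero_le _))) _
  obtain ⟨b, hb⟩ := exists_orthonormalBasis_apply_eq (0 : Idx d) hψ
  have hW : ∀ i, columns (ε i) ∈ Matrix.unitaryGroup (Fin (d i)) ℂ := fun i =>
    columns_mem_unitaryGroup (ε i)
  let U : Matrix.unitaryGroup (Idx d) ℂ := ⟨productOp (fun i => columns (ε i)) * star (columns b),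
    mul_mem (productOp_mem_unitaryGroup hW) (Unitary.star_mem (columns_mem_unitaryGroup b))⟩
  -- `U` takes `ψ` to the ground state, the column of `productOp fun i => columns (ε i)` at `0`.
  refine le_antisymm ((ciInf_le ⟨_, Set.forall_mem_range.2 hle⟩ U).trans_eq ?_) (le_ciInf hle)
  have hU : (U : Matrix (Idx d) (Idx d) ℂ) * ketBra ψ * (U : Matrix (Idx d) (Idx d) ℂ)ᴴ =
      productOp (fun i => columns (ε i)) * Matrix.single 0 0 1 *
        (productOp (fun i => columns (ε i)))ᴴ := by
    have hb' := columns_conjTranspose_mul b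
    rw [← hb, ketBra_orthonormalBasis]
    simp only [U, Matrix.star_eq_conjTranspose, Matrix.conjTranspose_mul,
      Matrix.conjTranspose_conjTranspose]
    generalize columns b = B at hb' ⊢
    generalize productOp (fun i => columns (ε i)) = W
    calc _ = W * (Bᴴ * B) * Matrix.single 0 0 1 * (Bᴴ * B) * Wᴴ := by
          simp only [Matrix.mul_assoc]
      _ = _ := by rw [hb', Matrix.mul_one, Matrix.mul_one]
  rw [hU, energy_totalHamiltonian]
  refine Finset.sum_eq_zero fun i _ => ?_
  rw [energy_conj, productOp_conj_extendOp i _ hW, conjTranspose_columns_mul_hamiltonian_mul,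
    energy, Matrix.trace_single_mul, extendOp_apply]
  simp [he0]

theorem ergotropicGap_eq_sum_passiveEnergy {n : ℕ} {d : Fin n → ℕ} [∀ i, NeZero (d i)]
    {e : ∀ i, Fin (d i) → ℝ} (he : ∀ i, Monotone (e i)) (he0 : ∀ i, e i 0 = 0)
    (ε : ∀ i, OrthonormalBasis (Fin (d i)) ℂ (EuclideanSpace ℂ (Fin (d i)))) {ψ : Space d}
    (hψ : ‖ψ‖ = 1) :
    ergotropicGap (fun i => hamiltonian (e i) (ε i)) ψ =
      ∑ i, passiveEnergy (reducedState_ketBra_isHermitian i ψ) (e i) := by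
  rw [ergotropicGap, globalErgotropy_eq he he0 ε hψ, localErgotropy_eq he ε ψ, sub_sub_cancel]

/-! ### LOCC protocols in Kraus form -/

theorem sum_productOp {n : ℕ} {d d' m : Fin n → ℕ}
    (A : ∀ i, Fin (m i) → Matrix (Fin (d' i)) (Fin (d i)) ℂ) :
    ∑ o : ∀ i, Fin (m i), productOp (fun i => A i (o i)) = productOp fun i => ∑ o, A i o := by
  ext x y
  simp only [productOp, Matrix.sum_apply, Matrix.of_apply, Finset.prod_univ_sum,
    Fintype.piFinset_univ]

/-- An LOCC channel is separable: its Kraus operators, one for each sequence of announced outcomes,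
are product operators. -/
theorem LOCCProtocol.exists_channel_eq_sum {n : ℕ} {e d : Fin n → ℕ} (P : LOCCProtocol e d) :
    ∃ (B : Type) (_ : Fintype B) (A : B → ∀ i, Matrix (Fin (e i)) (Fin (d i)) ℂ),
      ∑ b, (productOp (A b))ᴴ * productOp (A b) = 1 ∧
      ∀ ρ, P.channel ρ = ∑ b, productOp (A b) * ρ * (productOp (A b))ᴴ := by
  induction P with
  | halt =>
    refine ⟨Unit, inferInstance, fun _ i => 1, ?_, fun ρ => ?_⟩ <;>
      simp [productOp_one, LOCCProtocol.channel]
  | @round d d' m A hA next ih =>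
    choose B instB A' hA' hch using ih
    refine ⟨Σ o, B o, inferInstance, fun b i => A' b.1 b.2 i * A i (b.1 i), ?_, fun ρ => ?_⟩
    · simp only [← productOp_mul, Matrix.conjTranspose_mul]
      rw [Fintype.sum_sigma]
      have h : ∀ o, ∑ b : B o, (productOp fun i => A i (o i))ᴴ * (productOp (A' o b))ᴴ *
          (productOp (A' o b) * productOp fun i => A i (o i)) =
          productOp fun i => (A i (o i))ᴴ * A i (o i) := by
        intro o
        calc _ = (productOp fun i => A i (o i))ᴴ *
              (∑ b, (productOp (A' o b))ᴴ * productOp (A' o b)) *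
              productOp fun i => A i (o i) := by
              simp only [Matrix.mul_sum, Matrix.sum_mul, Matrix.mul_assoc]
          _ = _ := by rw [hA', Matrix.mul_one, productOp_conjTranspose, productOp_mul]
      simp only [h]
      rw [sum_productOp fun i o => (A i o)ᴴ * A i o]
      simp only [hA, productOp_one]
    · rw [LOCCProtocol.channel, Fintype.sum_sigma]
      refine Finset.sum_congr rfl fun o _ => ?_
      rw [hch]
      simp only [← productOp_mul, Matrix.conjTranspose_mul, Matrix.mul_assoc]

theorem energy_sum_left {I J : Type*} [Fintype I] (s : Finset J) (ρ : J → Matrix I I ℂ)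
    (A : Matrix I I ℂ) : energy (∑ j ∈ s, ρ j) A = ∑ j ∈ s, energy (ρ j) A := by
  simp [energy, Matrix.sum_mul, Matrix.trace_sum]

theorem energy_smul_left {I : Type*} [Fintype I] (r : ℝ) (ρ A : Matrix I I ℂ) :
    energy ((r : ℂ) • ρ) A = r * energy ρ A := by
  simp [energy, Matrix.trace_smul]

theorem ketBra_smul {I : Type*} [Fintype I] (c : ℂ) (v : EuclideanSpace ℂ I) :
    ketBra (c • v) = ((‖c‖ ^ 2 : ℝ) : ℂ) • ketBra v := by
  ext x y
  have h : c * star c = ((‖c‖ ^ 2 : ℝ) : ℂ) := by simpa using Complex.mul_conj' c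
  rw [← h]
  simp only [ketBra, Matrix.of_apply, Matrix.smul_apply, PiLp.smul_apply, smul_eq_mul, star_mul']
  ring

/-- Pure states are extreme: in a decomposition of a pure state into rank-one operators, all of them
are multiples of it. -/
theorem ketBra_eq_smul_of_sum_eq {I B : Type*} [Fintype I] [DecidableEq I] [Fintype B]
    {w : B → EuclideanSpace ℂ I} {φ : EuclideanSpace ℂ I} (hφ : ‖φ‖ = 1)
    (h : ∑ b, ketBra (w b) = ketBra φ) (b : B) :
    ∃ r : ℝ, 0 ≤ r ∧ ketBra (w b) = (r : ℂ) • ketBra φ := by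
  have hR : ∀ v : EuclideanSpace ℂ I,
      WithLp.toLp 2 ((1 - ketBra φ) *ᵥ v.ofLp) = v - inner ℂ φ v • φ := by
    intro v
    have hk : ketBra φ = Matrix.vecMulVec φ.ofLp (star φ.ofLp) := rfl
    ext x
    rw [hk, Matrix.sub_mulVec, Matrix.one_mulVec, Matrix.vecMulVec_mulVec,
      EuclideanSpace.inner_eq_star_dotProduct, dotProduct_comm]
    simp [mul_comm]
  -- The components orthogonal to `φ` sum to zero as positive operators, so each of them vanishes.
  have hz : ∑ b, ketBra (w b - inner ℂ φ (w b) • φ) = 0 := by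
    have h0 : φ - inner ℂ φ φ • φ = 0 := by simp [inner_self_eq_norm_sq_to_K, hφ]
    calc _ = (1 - ketBra φ) * (∑ b, ketBra (w b)) * (1 - ketBra φ)ᴴ := by
          simp only [Matrix.mul_sum, Matrix.sum_mul, conj_ketBra, hR]
      _ = 0 := by
          rw [h, conj_ketBra, hR, h0]
          ext
          simp [ketBra]
  have hsum : ∑ b, ‖w b - inner ℂ φ (w b) • φ‖ ^ 2 = 0 := by
    simp only [← energy_ketBra_one]
    rw [← energy_sum_left, hz]
    simp [energy]
  have hb := (Finset.sum_eq_zero_iff_of_nonneg fun b _ => sq_nonneg _).1 hsum b (Finset.mem_univ b)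
  rw [sq_eq_zero_iff, norm_eq_zero, sub_eq_zero] at hb
  exact ⟨‖inner ℂ φ (w b)‖ ^ 2, sq_nonneg _, by rw [← ketBra_smul, ← hb]⟩

/-! ### Monotonicity of the tails of the marginal spectra -/

/-- The orthogonal projection onto the span of the vectors of the basis `b` from number `k` on,
written as the Hamiltonian with energy `0` below level `k` and `1` from level `k` on. -/
noncomputable def tailProj {m : ℕ} (k : ℕ)
    (b : OrthonormalBasis (Fin m) ℂ (EuclideanSpace ℂ (Fin m))) : Matrix (Fin m) (Fin m) ℂ :=
  hamiltonian (fun j => if k ≤ j then 1 else 0) b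

theorem tailProj_posSemidef {m : ℕ} (k : ℕ)
    (b : OrthonormalBasis (Fin m) ℂ (EuclideanSpace ℂ (Fin m))) : (tailProj k b).PosSemidef :=
  hamiltonian_posSemidef (fun j => by split_ifs <;> norm_num) b

theorem tailProj_mul_self {m : ℕ} (k : ℕ)
    (b : OrthonormalBasis (Fin m) ℂ (EuclideanSpace ℂ (Fin m))) :
    tailProj k b * tailProj k b = tailProj k b := by
  rw [tailProj, hamiltonian_mul_hamiltonian]
  congr 1
  funext j
  split_ifs <;> simp

theorem one_sub_tailProj_posSemidef {m : ℕ} (k : ℕ)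
    (b : OrthonormalBasis (Fin m) ℂ (EuclideanSpace ℂ (Fin m))) :
    (1 - tailProj k b).PosSemidef := by
  have h : (1 - tailProj k b) = (1 - tailProj k b)ᴴ * (1 - tailProj k b) := by
    rw [Matrix.conjTranspose_sub, Matrix.conjTranspose_one, (tailProj_posSemidef k b).1.eq,
      sub_mul, mul_sub, mul_sub, tailProj_mul_self]
    simp
  rw [h]
  exact Matrix.posSemidef_conjTranspose_mul_self _

/-- An operator maps the span of the first `k` vectors of an orthonormal basis into the span of the
first `k` vectors of another one, which the Gram-Schmidt process yields. -/
theorem exists_tailProj_mul_mul_tailProj {m : ℕ} (k : ℕ) (A : Matrix (Fin m) (Fin m) ℂ)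
    (v : OrthonormalBasis (Fin m) ℂ (EuclideanSpace ℂ (Fin m))) :
    ∃ q : OrthonormalBasis (Fin m) ℂ (EuclideanSpace ℂ (Fin m)),
      tailProj k q * A * tailProj k v = tailProj k q * A := by
  let f : Fin m → EuclideanSpace ℂ (Fin m) := fun j => WithLp.toLp 2 (A *ᵥ (v j).ofLp)
  obtain ⟨q, hq⟩ : ∃ q : OrthonormalBasis (Fin m) ℂ (EuclideanSpace ℂ (Fin m)),
      ∀ j l, l < j → inner ℂ (q j) (f l) = 0 :=
    ⟨InnerProductSpace.gramSchmidtOrthonormalBasis finrank_euclideanSpace f, fun _ _ hlj =>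
      InnerProductSpace.gramSchmidtOrthonormalBasis_inv_triangular finrank_euclideanSpace f hlj⟩
  refine ⟨q, ?_⟩
  have hT : ∀ j l, l < j → ((columns q)ᴴ * A * columns v) j l = 0 := by
    intro j l hlj
    have h := hq j l hlj
    rw [EuclideanSpace.inner_eq_star_dotProduct, dotProduct_comm] at h
    rw [Matrix.mul_assoc, Matrix.mul_apply]
    exact h
  have hD : ∀ T : Matrix (Fin m) (Fin m) ℂ, (∀ j l, l < j → T j l = 0) →
      Matrix.diagonal (fun j : Fin m => (((if k ≤ j then 1 else 0 : ℝ)) : ℂ)) * T *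
        Matrix.diagonal (fun j : Fin m => (((if k ≤ j then 1 else 0 : ℝ)) : ℂ)) =
      Matrix.diagonal (fun j : Fin m => (((if k ≤ j then 1 else 0 : ℝ)) : ℂ)) * T := by
    intro T hT
    ext j l
    rw [Matrix.mul_diagonal, Matrix.diagonal_mul]
    by_cases hj : k ≤ (j : ℕ)
    · by_cases hl : k ≤ (l : ℕ)
      · simp [hl]
      · rw [hT j l (Fin.lt_def.2 (by omega))]
        simp
    · simp [hj]
  have hv := columns_mul_conjTranspose v
  have h := hD _ hT
  rw [tailProj, tailProj, hamiltonian_eq_conj_diagonal, hamiltonian_eq_conj_diagonal]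
  generalize columns v = V at hv h ⊢
  generalize columns q = Q at h ⊢
  generalize Matrix.diagonal (fun j : Fin m => (((if k ≤ j then 1 else 0 : ℝ)) : ℂ)) = D at h ⊢
  calc _ = Q * (D * (Qᴴ * A * V) * D) * Vᴴ := by simp only [Matrix.mul_assoc]
    _ = Q * D * Qᴴ * A * (V * Vᴴ) := by rw [h]; simp only [Matrix.mul_assoc]
    _ = _ := by rw [hv, Matrix.mul_one]

/-- The sum of all but the `k` largest eigenvalues of a marginal of a pure state does not increase
under a deterministic transformation by product Kraus operators. -/
theorem passiveEnergy_tail_le {n : ℕ} {d : Fin n → ℕ} {B : Type*} [Fintype B]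
    (A : B → ∀ i, Matrix (Fin (d i)) (Fin (d i)) ℂ)
    (hA : ∑ b, (productOp (A b))ᴴ * productOp (A b) = 1) {ψ φ : Space d} (hφ : ‖φ‖ = 1)
    (h : ∑ b, productOp (A b) * ketBra ψ * (productOp (A b))ᴴ = ketBra φ) (i : Fin n) (k : ℕ) :
    passiveEnergy (reducedState_ketBra_isHermitian i φ) (fun j => if k ≤ j then 1 else 0) ≤
      passiveEnergy (reducedState_ketBra_isHermitian i ψ) (fun j => if k ≤ j then 1 else 0) := by
  have hmono : Monotone fun j : Fin (d i) => if k ≤ (j : ℕ) then (1 : ℝ) else 0 := by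
    intro j l hjl
    have : (j : ℕ) ≤ l := hjl
    dsimp only
    split_ifs <;> first | omega | norm_num
  obtain ⟨v, hv⟩ := exists_eq_hamiltonian_spectrumDesc (reducedState_ketBra_isHermitian i ψ)
  choose q hq using fun b => exists_tailProj_mul_mul_tailProj k (A b i) v
  -- For the eigenbasis `v`, the energy of `tailProj k v` is the tail of the spectrum.
  have hψ : energy (ketBra ψ) (extendOp i (tailProj k v)) =
      passiveEnergy (reducedState_ketBra_isHermitian i ψ) (fun j => if k ≤ j then 1 else 0) := by
    rw [energy_extendOp]
    conv_lhs => rw [hv]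
    exact energy_hamiltonian_same _ _ v
  have hherm : (extendOp i (tailProj k v))ᴴ = extendOp i (tailProj k v) := by
    rw [extendOp_conjTranspose, (tailProj_posSemidef k v).1.eq]
  have hKraus : ∀ b, energy (ketBra ψ)
      ((productOp (A b))ᴴ * extendOp i (tailProj k (q b)) * productOp (A b)) ≤
      energy (ketBra ψ) (extendOp i (tailProj k v) * ((productOp (A b))ᴴ * productOp (A b)) *
        extendOp i (tailProj k v)) := by
    intro b
    have h1 : extendOp i (tailProj k (q b)) * productOp (A b) * extendOp i (tailProj k v) =
        extendOp i (tailProj k (q b)) * productOp (A b) := by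
      rw [extendOp_mul_productOp, productOp_mul_extendOp, Function.update_self, hq,
        Function.update_idem]
    have h2 : (extendOp i (tailProj k (q b)))ᴴ * extendOp i (tailProj k (q b)) =
        extendOp i (tailProj k (q b)) := by
      rw [extendOp_conjTranspose, (tailProj_posSemidef k _).1.eq, extendOp_mul, tailProj_mul_self]
    have h3 : ((1 : Matrix (Idx d) (Idx d) ℂ) - extendOp i (tailProj k (q b))).PosSemidef := by
      rw [← extendOp_one i, ← extendOp_sub]
      exact extendOp_posSemidef i (one_sub_tailProj_posSemidef k _)
    generalize extendOp i (tailProj k (q b)) = Q at h1 h2 h3 ⊢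
    generalize productOp (A b) = K at h1 ⊢
    generalize extendOp i (tailProj k v) = P at h1 hherm ⊢
    have h4 : Kᴴ * Q * K = P * (Kᴴ * Q * K) * P := by
      calc Kᴴ * Q * K = (Q * K)ᴴ * (Q * K) := by
            rw [Matrix.conjTranspose_mul, Matrix.mul_assoc, Matrix.mul_assoc, ← Matrix.mul_assoc Qᴴ,
              h2]
        _ = P * (Kᴴ * (Qᴴ * Q) * K) * P := by
            rw [← h1, Matrix.conjTranspose_mul, Matrix.conjTranspose_mul, hherm]
            simp only [Matrix.mul_assoc]
        _ = _ := by rw [h2]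
    have h5 : P * (Kᴴ * K) * P = Kᴴ * Q * K + (K * P)ᴴ * (1 - Q) * (K * P) := by
      rw [h4, Matrix.conjTranspose_mul, hherm]
      simp only [Matrix.mul_sub, Matrix.sub_mul, Matrix.mul_assoc, Matrix.one_mul]
      abel
    rw [h5, energy_add]
    exact le_add_of_nonneg_right (energy_ketBra_nonneg ψ (h3.conjTranspose_mul_mul_same _))
  have hupper : ∑ b, energy (productOp (A b) * ketBra ψ * (productOp (A b))ᴴ)
      (extendOp i (tailProj k (q b))) ≤ energy (ketBra ψ) (extendOp i (tailProj k v)) := by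
    simp only [energy_conj]
    refine (Finset.sum_le_sum fun b _ => hKraus b).trans_eq ?_
    rw [← energy_sum, ← Matrix.sum_mul, ← Matrix.mul_sum, hA, Matrix.mul_one, extendOp_mul,
      tailProj_mul_self]
  -- Every unnormalized output is a multiple of `φ`; the weights `r b` are the probabilities.
  simp only [conj_ketBra] at h hupper
  choose r hr hw using ketBra_eq_smul_of_sum_eq hφ h
  have hr1 : ∑ b, r b = 1 := by
    have h1 := congrArg (fun ρ => energy ρ 1) h
    simpa only [hw, energy_sum_left, energy_smul_left, energy_ketBra_one, hφ, one_pow,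
      mul_one] using h1
  rw [← hψ]
  refine le_trans ?_ hupper
  calc _ = ∑ b, r b * passiveEnergy (reducedState_ketBra_isHermitian i φ)
        (fun j => if k ≤ j then 1 else 0) := by rw [← Finset.sum_mul, hr1, one_mul]
    _ ≤ _ := Finset.sum_le_sum fun b _ => by
      rw [hw, energy_smul_left, energy_extendOp]
      exact mul_le_mul_of_nonneg_left (passiveEnergy_le_energy_hamiltonian _ hmono (q b)) (hr b)

/-! ### Energy levels as combinations of thresholds -/

theorem exists_sum_threshold_of_monotone {m : ℕ} {e : Fin m → ℝ} (he : Monotone e)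
    (he0 : ∀ j, 0 ≤ e j) :
    ∃ c : ℕ → ℝ, (∀ k < m, 0 ≤ c k) ∧
      ∀ j : Fin m, e j = ∑ k ∈ Finset.range m, c k * if k ≤ j then 1 else 0 := by
  -- The coefficients are the increments of the levels, extended by the junk value `0` beyond `m`.
  let f : ℕ → ℝ := fun l => if h : l < m then e ⟨l, h⟩ else 0
  have hf : ∀ j : Fin m, f j = e j := fun j => by simp [f]
  refine ⟨fun k => if k = 0 then f 0 else f k - f (k - 1), fun k hk => ?_, fun j => ?_⟩
  · rcases k with _ | k
    · simpa [f, hk] using he0 _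
    · have hk' : k < m := by omega
      simpa [f, hk, hk'] using he (Fin.mk_le_mk.2 (Nat.le_succ k))
  · simp only [mul_ite, mul_one, mul_zero]
    rw [← Finset.sum_filter]
    have hfil : (Finset.range m).filter (fun k => k ≤ (j : ℕ)) = Finset.range (j + 1) := by
      ext k
      simp only [Finset.mem_filter, Finset.mem_range]
      omega
    rw [hfil, Finset.sum_range_succ']
    simp only [Nat.add_eq_zero_iff, one_ne_zero, and_false, if_false, if_true,
      Nat.add_sub_cancel]
    rw [Finset.sum_range_sub, sub_add_cancel, hf]

theorem passiveEnergy_sum_threshold {m : ℕ} {ρ : Matrix (Fin m) (Fin m) ℂ} (hρ : ρ.IsHermitian)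
    {e : Fin m → ℝ} {c : ℕ → ℝ}
    (hc : ∀ j : Fin m, e j = ∑ k ∈ Finset.range m, c k * if k ≤ j then 1 else 0) :
    passiveEnergy hρ e =
      ∑ k ∈ Finset.range m, c k * passiveEnergy hρ (fun j => if k ≤ j then 1 else 0) := by
  simp only [passiveEnergy, hc, Finset.mul_sum]
  rw [Finset.sum_comm]
  exact Finset.sum_congr rfl fun k _ => Finset.sum_congr rfl fun j _ => by ring

end ErgotropicGap

theorem theorem1 {n : ℕ} (d : Fin n → ℕ) [∀ i, NeZero (d i)]
    (e : ∀ i, Fin (d i) → ℝ) (he : ∀ i, Monotone (e i)) (he0 : ∀ i, e i 0 = 0)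
    (ε : ∀ i, OrthonormalBasis (Fin (d i)) ℂ (EuclideanSpace ℂ (Fin (d i)))) :
    (∀ ψ : ErgotropicGap.Space d, ‖ψ‖ = 1 →
      ErgotropicGap.ergotropicGap (fun i => ErgotropicGap.hamiltonian (e i) (ε i)) ψ =
        ∑ i, ErgotropicGap.energy
          (ErgotropicGap.passiveState (ε i)
            (ErgotropicGap.reducedState_ketBra_isHermitian i ψ))
          (ErgotropicGap.hamiltonian (e i) (ε i))) ∧
    (∀ ψ φ : ErgotropicGap.Space d, ‖ψ‖ = 1 → ‖φ‖ = 1 →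
      ErgotropicGap.LOCCTransforms ψ φ →
      ErgotropicGap.ergotropicGap (fun i => ErgotropicGap.hamiltonian (e i) (ε i)) φ ≤
        ErgotropicGap.ergotropicGap (fun i => ErgotropicGap.hamiltonian (e i) (ε i)) ψ) := by
  refine ⟨fun ψ hψ => ?_, fun ψ φ hψ hφ hP => ?_⟩
  · rw [ErgotropicGap.ergotropicGap_eq_sum_passiveEnergy he he0 ε hψ]
    exact Finset.sum_congr rfl fun i _ => (ErgotropicGap.energy_passiveState _ _ _).symm
  · obtain ⟨P, hP⟩ := hP
    obtain ⟨B, _, A, hA, hch⟩ := P.exists_channel_eq_sum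
    rw [hch] at hP
    rw [ErgotropicGap.ergotropicGap_eq_sum_passiveEnergy he he0 ε hψ,
      ErgotropicGap.ergotropicGap_eq_sum_passiveEnergy he he0 ε hφ]
    refine Finset.sum_le_sum fun i _ => ?_
    obtain ⟨c, hc0, hc⟩ := ErgotropicGap.exists_sum_threshold_of_monotone (he i)
      fun j => (he0 i).symm.trans_le (he i (Fin.zero_le j))
    rw [ErgotropicGap.passiveEnergy_sum_threshold _ hc,
      ErgotropicGap.passiveEnergy_sum_threshold _ hc]
    exact Finset.sum_le_sum fun k hk => mul_le_mul_of_nonneg_left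
      (ErgotropicGap.passiveEnergy_tail_le A hA hφ hP i k) (hc0 k (Finset.mem_range.1 hk))
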